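/- All Banach spaces are real; $B_Y$ is the closed unit ball of $Y$. For a Banach space $Y$, a set $D\subseteq Y$ and $\rho>0$, define, with suprema taken in $[-\infty,+\infty]$ (so that $\sup\varnothing=-\infty$): - the $\rho$-inner radius $\mathrm{ir}(D,\rho)$: the supremum of all $r\ge 0$ such that $x+rB_Y\subseteq D$ for some $x\in\rho B_Y$; - the $\rho$-loose radius $\mathrm{lr}(D,\rho)$: the supremum of all $r\ge 0$ such that for every finite family $x_1,\dots,x_n\in rB_Y$ and every $\epsilon>0$ there are $y_1,\dots,y_n\in Y$ and $z\in\rho B_Y$ with $\|x_j-y_j\|<\epsilon$ and $z+y_j\in D$ for all $j\in\{1,\dots,n\}$. A Borel set $E$ in a separable Banach space $X$ is Haar null if there is a Borel probability measure $\mu$ on $X$ with $\mu(x+E)=0$ for every $x\in X$, and Haar positive if it is not Haar null. A Banach space $X$ is identified with its canonical image in its second dual $X^{**}$, and for $C\subseteq X$ we denote by $\mathrm{w}^*\text{-}\mathrm{cl}(C)$ the closure of $C$ in $X^{**}$ in the weak$^*$ topology $\sigma(X^{**},X^*)$. **Theorem.** Let $\rho>0$, let $C$ be a nonempty, closed, convex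 set in a Banach space $X$, and let $r\ge 0$. The following assertions are equivalent. 1. $\mathrm{lr}(C,\rho)\ge r$. 2. For every finite $F\subseteq rB_X$ there is $z\in\rho B_{X^{**}}$ such that $z+F\subseteq\mathrm{w}^*\text{-}\mathrm{cl}(C)$. 3. There is $z_0\in\rho B_{X^{**}}$ such that $z_0+rB_{X^{**}}\subseteq\mathrm{w}^*\text{-}\mathrm{cl}(C)$. In particular, $\mathrm{lr}(C,\rho)=\mathrm{ir}(\mathrm{w}^*\text{-}\mathrm{cl}(C),\rho)$, and if $X$ is separable, then $C$ is Haar positive if and only if $\mathrm{w}^*\text{-}\mathrm{cl}(C)$ has nonempty interior in the norm topology of $X^{**}$. -/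

import Mathlib

/-- The `ρ`-inner radius of a set `C`: the supremum of all `r ≥ 0` such that `C` contains a closed
ball of radius `r` whose centre has norm at most `ρ`. The supremum is taken in `[-∞, ∞]`, so it
is `⊥ = -∞` if there is no such `r` and `⊤ = +∞` if the `r` are unbounded. -/
noncomputable def innerRadius {Y : Type*} [NormedAddCommGroup Y] (C : Set Y) (ρ : ℝ) : EReal :=
  sSup ((fun r : ℝ => (r : EReal)) ''
    {r : ℝ | 0 ≤ r ∧ ∃ x : Y, ‖x‖ ≤ ρ ∧ Metric.closedBall x r ⊆ C})

/-- The `ρ`-loose radius of a set `C`: the supremum of all `r ≥ 0` such that for all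
`x₁, …, xₙ` of norm at most `r` and every `ε > 0` there are `y₁, …, yₙ` and `z` with `‖z‖ ≤ ρ`,
`‖xⱼ - yⱼ‖ < ε` and `z + yⱼ ∈ C` for all `j`. The supremum is again taken in `[-∞, ∞]`. -/
noncomputable def looseRadius {Y : Type*} [NormedAddCommGroup Y] (C : Set Y) (ρ : ℝ) : EReal :=
  sSup ((fun r : ℝ => (r : EReal)) ''
    {r : ℝ | 0 ≤ r ∧ ∀ (n : ℕ) (x : Fin n → Y), (∀ j, ‖x j‖ ≤ r) → ∀ ε : ℝ, 0 < ε →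
      ∃ (y : Fin n → Y) (z : Y), ‖z‖ ≤ ρ ∧ (∀ j, ‖x j - y j‖ < ε) ∧ ∀ j, z + y j ∈ C})

/-- The second dual of `X`, with the operator norm. -/
abbrev Bidual (X : Type*) [NormedAddCommGroup X] [NormedSpace ℝ X] : Type _ :=
  StrongDual ℝ (StrongDual ℝ X)

/-- The weak-* closure of a subset of a dual space, as a subset of the normed dual. -/
def weakStarClosure {V : Type*} [NormedAddCommGroup V] [NormedSpace ℝ V]
    (E : Set (StrongDual ℝ V)) : Set (StrongDual ℝ V) :=
  StrongDual.toWeakDual ⁻¹' closure (StrongDual.toWeakDual '' E)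

/-- The weak-* closure in the second dual of a subset `C` of `X`, where `X` is
embedded in `X**` canonically. -/
def bidualClosure {X : Type*} [NormedAddCommGroup X] [NormedSpace ℝ X] (C : Set X) :
    Set (Bidual X) :=
  weakStarClosure (NormedSpace.inclusionInDoubleDual ℝ X '' C)

/-- A Borel set `E` is Haar null if some Borel probability measure vanishes on all its translates.
The σ-algebra is meant to be the Borel one. -/
def IsHaarNull {X : Type*} [AddCommGroup X] [MeasurableSpace X] (E : Set X) : Prop :=
  MeasurableSet E ∧ ∃ μ : MeasureTheory.Measure X, MeasureTheory.IsProbabilityMeasure μ ∧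
    ∀ x : X, μ ((fun e => x + e) '' E) = 0

/-- A Borel set is Haar positive if it is not Haar null. -/
def IsHaarPositive {X : Type*} [AddCommGroup X] [MeasurableSpace X] (E : Set X) : Prop :=
  MeasurableSet E ∧ ¬ IsHaarNull E

/-! By Hahn–Banach, `bidualClosure C` is cut out by the half-spaces of functionals on `X` that
contain `C`. Looseness then gives a bidual ball by weak* compactness of the `ρ`-ball: each finite
set of approximate constraints on the centre is met by a point of `X`. Conversely, if translates of
finite sets fit in the closure, separation in `Xⁿ` returns the approximate translates to `X`.

Looseness with `r > 0` makes `C` Haar positive because `C` then contains a translate of every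
compact `K` in the ball of radius `r / 2` (`IsLoose.exists_forall_add_mem`), and every Borel
probability measure charges some translate of such a `K`.

If looseness fails for all positive `ρ`, `r`, a minimax argument (`isLoose_of_forall_measure`) gives
measures on arbitrarily small balls that assign at most `3 / 4` to every translate of `C` by a
vector of bounded norm, the bound being as large as desired. The law of a random series with such
independent terms is a witness of Haar nullity (`isHaarNull_of_forall_exists_measure`). -/

/-! ### Half-spaces and support functions -/

/-- Continuous linear functionals on a weak dual are evaluations. -/
theorem WeakDual.exists_eq_eval {𝕜 V : Type*} [NontriviallyNormedField 𝕜] [AddCommGroup V]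
    [TopologicalSpace V] [Module 𝕜 V] (F : WeakDual 𝕜 V →L[𝕜] 𝕜) :
    ∃ v : V, ∀ ψ : WeakDual 𝕜 V, F ψ = ψ v := by
  let G : WeakBilin (topDualPairing 𝕜 V) →L[𝕜] 𝕜 :=
    { toFun := fun ψ => F ψ
      map_add' := fun a b => map_add F a b
      map_smul' := fun a b => map_smul F a b
      cont := F.continuous }
  obtain ⟨v, hv⟩ := LinearMap.dualEmbedding_surjective (topDualPairing 𝕜 V) G
  exact ⟨v, fun ψ => (DFunLike.congr_fun hv ψ).symm⟩

/-- By the Hahn–Banach theorem, the weak-* closure in the second dual of a convex set is the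
intersection of the weak-* closed half-spaces that contain the set. -/
theorem mem_bidualClosure_iff {X : Type*} [NormedAddCommGroup X] [NormedSpace ℝ X]
    {C : Set X} (hconv : Convex ℝ C) {φ : Bidual X} :
    φ ∈ bidualClosure C ↔
      ∀ (f : StrongDual ℝ X) (s : ℝ), (∀ c ∈ C, f c ≤ s) → φ f ≤ s := by
  constructor
  · intro h f s hs
    have hcl : IsClosed {ψ : WeakDual ℝ (StrongDual ℝ X) | ψ f ≤ s} :=
      isClosed_le (WeakDual.eval_continuous f) continuous_const
    refine closure_minimal ?_ hcl h
    rintro _ ⟨_, ⟨c, hc, rfl⟩, rfl⟩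
    exact hs c hc
  · intro h
    by_contra hφ
    have hφ' : StrongDual.toWeakDual φ ∉ closure (StrongDual.toWeakDual ''
      (NormedSpace.inclusionInDoubleDual ℝ X '' C)) := hφ
    have hcv : Convex ℝ (closure (StrongDual.toWeakDual ''
        (NormedSpace.inclusionInDoubleDual ℝ X '' C))) := by
      refine Convex.closure ?_
      exact (hconv.linear_image (NormedSpace.inclusionInDoubleDual ℝ X).toLinearMap).linear_image
        (StrongDual.toWeakDual (𝕜 := ℝ) (E := StrongDual ℝ X)).toLinearMap
    have : LocallyConvexSpace ℝ (WeakDual ℝ (StrongDual ℝ X)) :=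
      (WeakDual.withSeminorms (𝕜 := ℝ) (E := StrongDual ℝ X)).toLocallyConvexSpace
    obtain ⟨F, u, hF, hu⟩ := geometric_hahn_banach_closed_point hcv isClosed_closure hφ'
    obtain ⟨f, hFf⟩ := WeakDual.exists_eq_eval F
    have h1 := h f u fun c hc => by
      have := hF _ (subset_closure ⟨_, ⟨c, hc, rfl⟩, rfl⟩)
      rw [hFf] at this
      exact this.le
    rw [hFf] at hu
    exact absurd hu (not_lt.2 h1)

/-- The support function of the ball of radius `r` is `r * ‖f‖`; this turns containment of balls
into inequalities between functionals. -/
theorem mul_norm_le_of_forall_le {X : Type*} [NormedAddCommGroup X] [NormedSpace ℝ X]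
    {r M : ℝ} (hr : 0 ≤ r) (f : StrongDual ℝ X) (h : ∀ x : X, ‖x‖ ≤ r → f x ≤ M) :
    r * ‖f‖ ≤ M := by
  have hM : 0 ≤ M := by simpa using h 0 (by simpa using hr)
  rcases hr.eq_or_lt with rfl | hr
  · simpa using hM
  have : ‖f‖ ≤ M / r := by
    refine f.opNorm_le_bound (by positivity) fun x => ?_
    rcases eq_or_ne x 0 with rfl | hx
    · simp
    have hx : 0 < ‖x‖ := norm_pos_iff.2 hx
    have hn : ‖(r / ‖x‖) • x‖ ≤ r := by
      rw [norm_smul, Real.norm_of_nonneg (by positivity), div_mul_cancel₀ _ hx.ne']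
    have h1 := h ((r / ‖x‖) • x) hn
    have h2 := h (-((r / ‖x‖) • x)) (by rwa [norm_neg])
    rw [map_neg] at h2
    rw [map_smul, smul_eq_mul] at h1 h2
    have h3 : r / ‖x‖ * |f x| ≤ M := by
      rcases abs_cases (f x) with ⟨h, _⟩ | ⟨h, _⟩ <;> rw [h] <;> linarith
    rw [Real.norm_eq_abs]
    calc |f x| = (r / ‖x‖ * |f x|) * (‖x‖ / r) := by field_simp
      _ ≤ M * (‖x‖ / r) := by gcongr
      _ = _ := by ring
  rw [le_div_iff₀ hr] at this
  linarith

/-! ### Looseness and the loose radius -/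

/-- The condition on `r` in the definition of the `ρ`-loose radius. -/
def IsLoose {Y : Type*} [NormedAddCommGroup Y] (C : Set Y) (ρ r : ℝ) : Prop :=
  ∀ (n : ℕ) (x : Fin n → Y), (∀ j, ‖x j‖ ≤ r) → ∀ ε : ℝ, 0 < ε →
    ∃ (y : Fin n → Y) (z : Y), ‖z‖ ≤ ρ ∧ (∀ j, ‖x j - y j‖ < ε) ∧ ∀ j, z + y j ∈ C

theorem IsLoose.mono {Y : Type*} [NormedAddCommGroup Y] {C : Set Y} {ρ r s : ℝ}
    (h : IsLoose C ρ r) (hs : s ≤ r) : IsLoose C ρ s :=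
  fun n x hx => h n x fun j => (hx j).trans hs

/-- Shrinking the points by a factor `t` near `1` moves them by at most `(1 - t) * r`, which `ε`
absorbs. Hence the supremum defining the loose radius is attained when it is finite and positive. -/
theorem isLoose_of_forall_lt {X : Type*} [NormedAddCommGroup X] [NormedSpace ℝ X] {C : Set X}
    {ρ r : ℝ} (hr : 0 < r) (h : ∀ s, 0 ≤ s → s < r → IsLoose C ρ s) : IsLoose C ρ r := by
  intro n x hx ε hε
  obtain ⟨t, ht0, ht1, htε⟩ : ∃ t : ℝ, 0 ≤ t ∧ t < 1 ∧ (1 - t) * r < ε / 2 := by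
    refine ⟨max 0 (1 - ε / (4 * r)), le_max_left _ _, max_lt one_pos ?_, ?_⟩
    · have : 0 < ε / (4 * r) := by positivity
      linarith
    · have : 1 - max 0 (1 - ε / (4 * r)) ≤ ε / (4 * r) := by
        linarith [le_max_right 0 (1 - ε / (4 * r))]
      calc _ ≤ ε / (4 * r) * r := by gcongr
        _ = ε / 4 := by field_simp
        _ < _ := by linarith
  obtain ⟨y, z, hz, hy, hC⟩ := h (t * r) (by positivity) (by nlinarith) n (fun j => t • x j)
    (fun j => by
      rw [norm_smul, Real.norm_of_nonneg ht0]
      exact mul_le_mul_of_nonneg_left (hx j) ht0) (ε / 2) (by positivity)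
  refine ⟨y, z, hz, fun j => ?_, hC⟩
  have h1 : x j - y j = (1 - t) • x j + (t • x j - y j) := by
    rw [sub_smul, one_smul]
    abel
  have h2 : ‖(1 - t) • x j‖ ≤ (1 - t) * r := by
    rw [norm_smul, Real.norm_of_nonneg (by linarith)]
    exact mul_le_mul_of_nonneg_left (hx j) (by linarith)
  rw [h1]
  linarith [norm_add_le ((1 - t) • x j) (t • x j - y j), hy j]

theorem le_looseRadius_iff {X : Type*} [NormedAddCommGroup X] [NormedSpace ℝ X] {C : Set X}
    {ρ r : ℝ} (hr : 0 ≤ r) : (r : EReal) ≤ looseRadius C ρ ↔ IsLoose C ρ r := by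
  constructor
  · intro h
    have key : ∀ s : ℝ, (s : EReal) < looseRadius C ρ → IsLoose C ρ s := by
      intro s hs
      obtain ⟨_, ⟨t, ⟨_, ht⟩, rfl⟩, hst⟩ := lt_sSup_iff.1 hs
      exact IsLoose.mono (r := t) ht (EReal.coe_lt_coe_iff.1 hst).le
    rcases hr.eq_or_lt with rfl | hr
    -- No smaller radius is available at `r = 0`; the supremum exceeds `⊥`, so some admissible `t ≥
    -- 0` exists.
    · obtain ⟨_, ⟨t, ⟨ht, htC⟩, rfl⟩, -⟩ := lt_sSup_iff.1 (EReal.bot_lt_zero.trans_le h)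
      exact IsLoose.mono (r := t) htC ht
    · exact isLoose_of_forall_lt hr fun s _ hs =>
        key s ((EReal.coe_lt_coe_iff.2 hs).trans_le h)
  · exact fun h => le_sSup ⟨r, ⟨hr, h⟩, rfl⟩

/-! ### Looseness and balls in the bidual -/

theorem exists_closedBall_subset_of_isLoose {X : Type*} [NormedAddCommGroup X] [NormedSpace ℝ X]
    {C : Set X} (hconv : Convex ℝ C) {ρ r : ℝ} (hr : 0 ≤ r) (h : IsLoose C ρ r) :
    ∃ z₀ : Bidual X, ‖z₀‖ ≤ ρ ∧ Metric.closedBall z₀ r ⊆ bidualClosure C := by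
  -- For `p = (x, δ)`: the centres `z` for which `z + x` satisfies every half-space constraint of
  -- `C` up to `δ * ‖f‖`. Only finitely many `p` are met at once, so looseness with the least
  -- tolerance yields a common point.
  let t : {p : X × ℝ // ‖p.1‖ ≤ r ∧ 0 < p.2} → Set (WeakDual ℝ (StrongDual ℝ X)) := fun p =>
    {z | ∀ (f : StrongDual ℝ X) (s : ℝ), (∀ c ∈ C, f c ≤ s) → z f + f p.1.1 ≤ s + p.1.2 * ‖f‖}
  have hclosed : ∀ p, IsClosed (t p) := by
    intro p
    simp only [t, Set.ofPred_forall]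
    exact isClosed_iInter fun f => isClosed_iInter fun s => isClosed_iInter fun _ =>
      isClosed_le ((WeakDual.eval_continuous f).add continuous_const) continuous_const
  obtain ⟨z, hz, hzt⟩ := (WeakDual.isCompact_closedBall (𝕜 := ℝ)
      (0 : StrongDual ℝ (StrongDual ℝ X)) ρ).inter_iInter_nonempty t hclosed (by
    intro u
    obtain ⟨ε, hε, hεu⟩ : ∃ ε > 0, ∀ p ∈ u, ε ≤ p.1.2 := by
      rcases u.eq_empty_or_nonempty with rfl | hu
      · exact ⟨1, one_pos, by simp⟩
      · obtain ⟨q, hq, hmin⟩ := u.exists_min_image (fun p => p.1.2) hu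
        exact ⟨q.1.2, q.2.2, hmin⟩
    obtain ⟨y, z, hz, hy, hC⟩ := h u.card (fun j => (u.equivFin.symm j).1.1.1)
      (fun j => (u.equivFin.symm j).1.2.1) ε hε
    refine ⟨StrongDual.toWeakDual (NormedSpace.inclusionInDoubleDual ℝ X z), ?_, ?_⟩
    · have := (NormedSpace.double_dual_bound ℝ X z).trans hz
      simpa using this
    · simp only [Set.mem_iInter]
      intro p hp f s hs
      have h1 := hy (u.equivFin ⟨p, hp⟩)
      have h2 := hs _ (hC (u.equivFin ⟨p, hp⟩))
      simp only [Equiv.symm_apply_apply] at h1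
      set y' := y (u.equivFin ⟨p, hp⟩)
      change f z + f p.1.1 ≤ s + p.1.2 * ‖f‖
      have h3 : f p.1.1 - f y' ≤ p.1.2 * ‖f‖ := by
        rw [← map_sub]
        calc f (p.1.1 - y') ≤ ‖f (p.1.1 - y')‖ := le_abs_self _
          _ ≤ ‖f‖ * ‖p.1.1 - y'‖ := f.le_opNorm _
          _ ≤ ‖f‖ * p.1.2 := by gcongr; exact h1.le.trans (hεu p hp)
          _ = _ := mul_comm _ _
      rw [map_add] at h2
      linarith)
  refine ⟨WeakDual.toStrongDual z, by simpa using hz, fun φ hφ => ?_⟩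
  rw [mem_bidualClosure_iff hconv]
  intro f s hs
  have h1 : r * ‖f‖ ≤ s - z f := by
    refine mul_norm_le_of_forall_le hr f fun x hx => ?_
    refine le_of_forall_pos_le_add fun δ hδ => ?_
    have h2 := Set.mem_iInter.1 hzt ⟨(x, δ / (‖f‖ + 1)), hx, by positivity⟩ f s hs
    have h3 : δ / (‖f‖ + 1) * ‖f‖ ≤ δ := by
      rw [div_mul_eq_mul_div, div_le_iff₀ (by positivity)]
      nlinarith
    simp only at h2
    linarith
  have h4 : φ f - z f ≤ r * ‖f‖ := by
    have : ‖φ - WeakDual.toStrongDual z‖ ≤ r :=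
      (mem_closedBall_iff_norm (E := Bidual X)).1 hφ
    calc φ f - z f = (φ - WeakDual.toStrongDual z) f := rfl
      _ ≤ ‖(φ - WeakDual.toStrongDual z) f‖ := le_abs_self _
      _ ≤ ‖φ - WeakDual.toStrongDual z‖ * ‖f‖ := ContinuousLinearMap.le_opNorm _ _
      _ ≤ _ := by gcongr
  linarith

/-- The tuples that a vector of the `ρ`-ball translates into `C` form a convex set `A`, and
looseness says that `x` lies in its closure. A functional on `Xⁿ` separating them is a tuple `g` of
functionals, and only the values of `z₀` at the `g j` and their sum matter. -/
theorem isLoose_of_forall_finite {X : Type*} [NormedAddCommGroup X] [NormedSpace ℝ X]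
    {C : Set X} (hconv : Convex ℝ C) {ρ r : ℝ} (hρ : 0 ≤ ρ)
    (h : ∀ F : Set X, F.Finite → F ⊆ Metric.closedBall 0 r →
      ∃ z : Bidual X, ‖z‖ ≤ ρ ∧
        ∀ x ∈ F, z + NormedSpace.inclusionInDoubleDual ℝ X x ∈ bidualClosure C) :
    IsLoose C ρ r := by
  intro n x hx ε hε
  obtain ⟨z₀, hz₀, hzC⟩ := h (Set.range x) (Set.finite_range x) (by
    rintro _ ⟨j, rfl⟩
    simpa using hx j)
  let A : Set (Fin n → X) := {a | ∃ z : X, ‖z‖ ≤ ρ ∧ ∀ j, z + a j ∈ C}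
  have hA : Convex ℝ A := by
    rintro a ⟨z, hz, ha⟩ b ⟨w, hw, hb⟩ s t hs ht hst
    refine ⟨s • z + t • w, ?_, fun j => ?_⟩
    · have := (convex_closedBall (0 : X) ρ) (mem_closedBall_zero_iff.2 hz)
        (mem_closedBall_zero_iff.2 hw) hs ht hst
      exact mem_closedBall_zero_iff.1 this
    · have := hconv (ha j) (hb j) hs ht hst
      convert this using 1
      simp only [Pi.add_apply, Pi.smul_apply, smul_add]
      abel
  have hxA : x ∈ closure A := by
    by_contra hx
    obtain ⟨f, u, hfx, hfu⟩ := geometric_hahn_banach_point_closed hA.closure isClosed_closure hx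
    let g : Fin n → StrongDual ℝ X := fun j => f.comp (ContinuousLinearMap.single ℝ (fun _ => X) j)
    have hfg : ∀ a, f a = ∑ j, g j (a j) := by
      intro a
      conv_lhs => rw [← Finset.univ_sum_single a, map_sum]
      rfl
    let G : StrongDual ℝ X := ∑ j, g j
    have hG : ∀ v, G v = ∑ j, g j v := fun v => by simp [G]
    have hz₀G : z₀ G = ∑ j, z₀ (g j) := map_sum _ _ _
    -- The separation gap is shared by `n + 1` errors: one for each `c j`, one for replacing `z₀` by
    -- a vector of `X`.
    let δ := (u - f x) / (n + 1)
    have hδ : 0 < δ := div_pos (by linarith) (by positivity)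
    have hδn : (n + 1) * δ = u - f x := by
      simp only [δ]
      field_simp
    have hc : ∀ j, ∃ c ∈ C, g j c < z₀ (g j) + g j (x j) + δ := by
      intro j
      by_contra! hcon
      have := (mem_bidualClosure_iff hconv).1 (hzC (x j) ⟨j, rfl⟩) (-g j)
        (-(z₀ (g j) + g j (x j) + δ)) fun c hc => by simpa using neg_le_neg (hcon c hc)
      simp only [map_neg, add_apply, NormedSpace.dual_def] at this
      linarith
    obtain ⟨z, hz, hzG⟩ : ∃ z : X, ‖z‖ ≤ ρ ∧ z₀ G - δ < G z := by
      by_contra! hcon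
      have h1 := mul_norm_le_of_forall_le hρ G hcon
      have h2 : z₀ G ≤ ρ * ‖G‖ := (le_abs_self _).trans <| (z₀.le_opNorm G).trans (by gcongr)
      linarith
    choose c hcC hc using hc
    have h1 := hfu (fun j => c j - z) (subset_closure ⟨z, hz, fun j => by simpa using hcC j⟩)
    have h2 : f (fun j => c j - z) = ∑ j, g j (c j) - G z := by
      rw [hfg, hG, ← Finset.sum_sub_distrib]
      simp
    have h3 : ∑ j, g j (c j) ≤ z₀ G + f x + n * δ := by
      rw [hz₀G, hfg, ← Finset.sum_add_distrib]
      calc _ ≤ ∑ j, (z₀ (g j) + g j (x j) + δ) := Finset.sum_le_sum fun j _ => (hc j).le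
        _ = _ := by simp [Finset.sum_add_distrib]
    linarith
  obtain ⟨y, ⟨z, hz, hy⟩, hxy⟩ := Metric.mem_closure_iff.1 hxA ε hε
  refine ⟨y, z, hz, fun j => ?_, hy⟩
  rw [← dist_eq_norm]
  exact (dist_le_pi_dist x y j).trans_lt hxy

theorem add_inclusionInDoubleDual_mem_closedBall {X : Type*} [NormedAddCommGroup X]
    [NormedSpace ℝ X] {r : ℝ} (z : Bidual X) {x : X} (hx : x ∈ Metric.closedBall 0 r) :
    z + NormedSpace.inclusionInDoubleDual ℝ X x ∈ Metric.closedBall z r := by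
  refine (mem_closedBall_iff_norm (E := Bidual X)).2 ?_
  rw [add_sub_cancel_left (G := Bidual X)]
  exact (NormedSpace.double_dual_bound ℝ X x).trans (mem_closedBall_zero_iff.1 hx)

theorem exists_closedBall_subset_iff_isLoose {X : Type*} [NormedAddCommGroup X] [NormedSpace ℝ X]
    {C : Set X} (hconv : Convex ℝ C) {ρ r : ℝ} (hρ : 0 ≤ ρ) (hr : 0 ≤ r) :
    (∃ z₀ : Bidual X, ‖z₀‖ ≤ ρ ∧ Metric.closedBall z₀ r ⊆ bidualClosure C) ↔ IsLoose C ρ r :=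
  ⟨fun ⟨z, hz, hzC⟩ => isLoose_of_forall_finite hconv hρ fun _ _ hF => ⟨z, hz, fun _ hx =>
    hzC (add_inclusionInDoubleDual_mem_closedBall z (hF hx))⟩,
    exists_closedBall_subset_of_isLoose hconv hr⟩

theorem looseRadius_eq_innerRadius_bidualClosure {X : Type*} [NormedAddCommGroup X]
    [NormedSpace ℝ X] {C : Set X} (hconv : Convex ℝ C) {ρ : ℝ} (hρ : 0 ≤ ρ) :
    looseRadius C ρ = innerRadius (bidualClosure C) ρ := by
  unfold looseRadius innerRadius
  congr 2
  ext r
  simp only [Set.mem_ofPred_eq]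
  exact and_congr_right fun hr => (exists_closedBall_subset_iff_isLoose hconv hρ hr).symm

theorem interior_bidualClosure_nonempty_iff {X : Type*} [NormedAddCommGroup X] [NormedSpace ℝ X]
    {C : Set X} (hconv : Convex ℝ C) :
    (interior (bidualClosure C)).Nonempty ↔ ∃ ρ > 0, ∃ r > 0, IsLoose C ρ r := by
  constructor
  · rintro ⟨z, hz⟩
    obtain ⟨r, hr, hzr⟩ := (Metric.nhds_basis_closedBall (α := Bidual X)).mem_iff.1
      (mem_interior_iff_mem_nhds.1 hz)
    exact ⟨‖z‖ + 1, by positivity, r, hr, (exists_closedBall_subset_iff_isLoose hconv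
      (by positivity) hr.le).1 ⟨z, by linarith, hzr⟩⟩
  · rintro ⟨ρ, hρ, r, hr, h⟩
    obtain ⟨z, -, hz⟩ := exists_closedBall_subset_of_isLoose hconv hr.le h
    exact ⟨z, mem_interior_iff_mem_nhds.2
      (Filter.mem_of_superset (Metric.closedBall_mem_nhds z hr) hz)⟩

/-! ### Looseness implies Haar positivity -/

/-- Looseness, applied to a finite `r / 4`-net `p` of `2K`, gives `y` with `‖p j - y j‖ < r / 4`.
Each `2x` is then within `r / 2` of some `y j`, and the remainder `k = 2x - y j` is back in the half
ball, so the step can be iterated. -/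
theorem IsLoose.exists_compact_step {X : Type*} [NormedAddCommGroup X] [NormedSpace ℝ X]
    {C : Set X} {ρ r : ℝ} (hr : 0 < r) (h : IsLoose C ρ r) {K : Set X} (hK : IsCompact K)
    (hKr : K ⊆ Metric.closedBall 0 (r / 2)) :
    ∃ (K' : Set X) (z : X), (IsCompact K' ∧ K' ⊆ Metric.closedBall 0 (r / 2)) ∧ ‖z‖ ≤ ρ ∧
      ∀ x ∈ K, ∃ k ∈ K', z + ((2 : ℝ) • x - k) ∈ C := by
  have h2K : IsCompact ((fun x : X => (2 : ℝ) • x) '' K) := hK.image (continuous_const_smul _)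
  have hr4 : 0 < r / 4 := by positivity
  obtain ⟨t, htK, htf, hcov⟩ := h2K.finite_cover_balls hr4
  obtain ⟨n, p, -, rfl⟩ := htf.fin_param
  obtain ⟨y, z, hz, hy, hC⟩ := h n p (fun j => by
    obtain ⟨x, hx, hxp⟩ := htK ⟨j, rfl⟩
    rw [← hxp, norm_smul, Real.norm_of_nonneg zero_le_two]
    linarith [mem_closedBall_zero_iff.1 (hKr hx)]) (r / 4) hr4
  refine ⟨(⋃ j, (fun x : X => (2 : ℝ) • x - y j) '' K) ∩ Metric.closedBall 0 (r / 2), z,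
    ⟨IsCompact.inter_right (isCompact_iUnion fun j => hK.image (by fun_prop))
      Metric.isClosed_closedBall, Set.inter_subset_right⟩, hz, fun x hx => ?_⟩
  obtain ⟨_, ⟨j, rfl⟩, hj⟩ := Set.mem_iUnion₂.1 (hcov ⟨x, hx, rfl⟩)
  refine ⟨(2 : ℝ) • x - y j, ⟨Set.mem_iUnion.2 ⟨j, x, hx, rfl⟩, ?_⟩, by simpa using hC j⟩
  rw [mem_closedBall_zero_iff]
  have h1 := mem_ball_iff_norm.1 hj
  have h2 := norm_sub_le_norm_sub_add_norm_sub ((2 : ℝ) • x) (p j) (y j)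
  linarith [hy j]

/-- Iterating `v (n + 1) = 2 v n - y n` from `v 0 = x` expands `x` as `∑ 2⁻⁽ⁿ⁺¹⁾ y n` with `z n + y
n ∈ C`. Thus `∑ 2⁻⁽ⁿ⁺¹⁾ z n + x` is an infinite convex combination of points of `C`. The `z n`
depend on the compact sets only, so one translate serves all `x`. -/
theorem IsLoose.exists_forall_add_mem {X : Type*} [NormedAddCommGroup X] [NormedSpace ℝ X]
    [CompleteSpace X] {C : Set X} (hclosed : IsClosed C) (hconv : Convex ℝ C) {ρ r : ℝ}
    (hr : 0 < r) (h : IsLoose C ρ r) {K : Set X} (hK : IsCompact K)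
    (hKr : K ⊆ Metric.closedBall 0 (r / 2)) : ∃ z, ∀ x ∈ K, z + x ∈ C := by
  have step : ∀ K : {K : Set X // IsCompact K ∧ K ⊆ Metric.closedBall 0 (r / 2)},
      ∃ (K' : {K : Set X // IsCompact K ∧ K ⊆ Metric.closedBall 0 (r / 2)}) (z : X), ‖z‖ ≤ ρ ∧
        ∀ x ∈ K.1, ∃ k ∈ K'.1, z + ((2 : ℝ) • x - k) ∈ C := fun K => by
    obtain ⟨K', z, hK', h'⟩ := h.exists_compact_step hr K.2.1 K.2.2
    exact ⟨⟨K', hK'⟩, z, h'⟩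
  choose next z hz hnext using step
  let Q : ℕ → {K : Set X // IsCompact K ∧ K ⊆ Metric.closedBall 0 (r / 2)} :=
    fun n => next^[n] ⟨K, hK, hKr⟩
  have hQ : ∀ n, Q (n + 1) = next (Q n) := fun n => Function.iterate_succ_apply' _ _ _
  let w : ℕ → X := fun n => ((1 / 2 : ℝ) ^ (n + 1)) • z (Q n)
  have hw : Summable w := by
    refine Summable.of_norm_bounded (g := fun n => (1 / 2 : ℝ) ^ n * ((1 / 2) * ρ))
      (summable_geometric_two.mul_right _) fun n => ?_
    simp only [w]
    rw [norm_smul, Real.norm_of_nonneg (by positivity), pow_succ, mul_assoc]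
    gcongr
    exact hz _
  refine ⟨∑' n, w n, fun x hx => ?_⟩
  choose! k hkQ hkC using hnext
  let v : ℕ → X := fun n => Nat.rec x (fun m y => k (Q m) y) n
  have hv : ∀ n, v (n + 1) = k (Q n) (v n) := fun n => rfl
  have hvQ : ∀ n, v n ∈ (Q n).1 := by
    intro n
    induction n with
    | zero => exact hx
    | succ n ih =>
      rw [hQ, hv]
      exact hkQ _ _ ih
  have hvC : ∀ n, z (Q n) + ((2 : ℝ) • v n - v (n + 1)) ∈ C := fun n => hkC _ _ (hvQ n)
  -- The partial sums have total weight `1 - 2⁻ⁿ`; an arbitrary `c ∈ C` takes up the remaining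
  -- `2⁻ⁿ`.
  have hpart : ∀ n, ∀ c ∈ C,
      (∑ i ∈ Finset.range n, w i) + (x - (1 / 2 : ℝ) ^ n • v n) + (1 / 2 : ℝ) ^ n • c ∈ C := by
    intro n
    induction n with
    | zero =>
      intro c hc
      simpa [v] using hc
    | succ n ih =>
      intro c hc
      have := ih _ (hconv (hvC n) hc (a := 1 / 2) (b := 1 / 2) (by norm_num) (by norm_num)
        (by norm_num))
      convert this using 1
      rw [Finset.sum_range_succ]
      simp only [w]
      module
  have hpow : Filter.Tendsto (fun n : ℕ => (1 / 2 : ℝ) ^ n) Filter.atTop (nhds 0) :=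
    tendsto_pow_atTop_nhds_zero_of_lt_one (by norm_num) (by norm_num)
  have hv0 : Filter.Tendsto (fun n : ℕ => (1 / 2 : ℝ) ^ n • v n) Filter.atTop (nhds 0) := by
    refine hpow.zero_smul_isBoundedUnder_le ?_
    exact Filter.isBoundedUnder_of
      ⟨r / 2, fun n => mem_closedBall_zero_iff.1 ((Q n).2.2 (hvQ n))⟩
  set c := z (Q 0) + ((2 : ℝ) • v 0 - v (0 + 1))
  have hlim : Filter.Tendsto (fun n : ℕ => (∑ i ∈ Finset.range n, w i) +
      (x - (1 / 2 : ℝ) ^ n • v n) + (1 / 2 : ℝ) ^ n • c) Filter.atTop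
      (nhds (∑' n, w n + (x - 0) + (0 : ℝ) • c)) :=
    (hw.hasSum.tendsto_sum_nat.add (tendsto_const_nhds.sub hv0)).add (hpow.smul_const c)
  have := hclosed.mem_of_tendsto hlim (Filter.Eventually.of_forall fun n => hpart n c (hvC 0))
  simpa using this

theorem IsLoose.isHaarPositive {X : Type*} [NormedAddCommGroup X] [NormedSpace ℝ X]
    [CompleteSpace X] [MeasurableSpace X] [BorelSpace X] [TopologicalSpace.SeparableSpace X]
    {C : Set X} (hclosed : IsClosed C) (hconv : Convex ℝ C) {ρ r : ℝ}
    (hr : 0 < r) (h : IsLoose C ρ r) : IsHaarPositive C := by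
  refine ⟨hclosed.measurableSet, ?_⟩
  rintro ⟨-, μ, hμ, hC⟩
  have : SecondCountableTopology X := UniformSpace.secondCountable_of_separable X
  obtain ⟨a, -, ha⟩ := MeasureTheory.exists_mem_forall_mem_nhdsWithin_pos_measure
    (μ := μ) (s := Set.univ) (by simp)
  have hpos : 0 < μ (Metric.closedBall a (r / 2)) := by
    refine ha _ ?_
    rw [nhdsWithin_univ]
    exact Metric.closedBall_mem_nhds a (by positivity)
  obtain ⟨K, hKa, hK, hKμ⟩ := Metric.isClosed_closedBall.measurableSet.exists_lt_isCompact hpos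
  obtain ⟨z, hz⟩ := h.exists_forall_add_mem hclosed hconv hr
    (K := (fun x => x - a) '' K) (hK.image (by fun_prop)) (by
      rintro _ ⟨x, hx, rfl⟩
      exact mem_closedBall_zero_iff.2 (mem_closedBall_iff_norm.1 (hKa hx)))
  refine hKμ.ne' (MeasureTheory.measure_mono_null ?_ (hC (a - z)))
  exact fun x hx => ⟨z + (x - a), hz _ ⟨x, hx, rfl⟩, by
    change a - z + (z + (x - a)) = x
    abel⟩

/-! ### Null events in product spaces and random series -/

open MeasureTheory in
/-- Resampling one coordinate preserves a product of probability measures. -/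
theorem MeasureTheory.Measure.map_update_prod_infinitePi {ι : Type*} [DecidableEq ι]
    {X : ι → Type*} [∀ i, MeasurableSpace (X i)] (ν : ∀ i, Measure (X i))
    [∀ i, IsProbabilityMeasure (ν i)] (m : ι) :
    ((Measure.infinitePi ν).prod (ν m)).map (fun p => Function.update p.1 m p.2) =
      Measure.infinitePi ν := by
  refine Measure.eq_infinitePi ν fun s t ht => ?_
  have hmeas : MeasurableSet (Set.pi (s : Set ι) t) :=
    MeasurableSet.pi s.countable_toSet fun i _ => ht i
  rw [Measure.map_apply measurable_update' hmeas]
  by_cases hm : m ∈ s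
  · have : (fun p : (∀ i, X i) × X m => Function.update p.1 m p.2) ⁻¹' Set.pi (s : Set ι) t =
        Set.pi ((s.erase m : Finset ι) : Set ι) t ×ˢ t m := by
      ext ⟨ω, x⟩
      simp only [Set.mem_preimage, Set.mem_pi, Set.mem_prod, Finset.mem_coe, Finset.mem_erase]
      constructor
      · intro h
        refine ⟨fun i hi => ?_, by simpa using h m hm⟩
        simpa [hi.1] using h i hi.2
      · rintro ⟨h, hx⟩ i hi
        rcases eq_or_ne i m with rfl | him
        · simpa using hx
        · simpa [him] using h i ⟨him, hi⟩
    rw [this, Measure.prod_prod, Measure.infinitePi_pi ν fun i _ => ht i, mul_comm,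
      Finset.mul_prod_erase s (fun i => ν i (t i)) hm]
  · have : (fun p : (∀ i, X i) × X m => Function.update p.1 m p.2) ⁻¹' Set.pi (s : Set ι) t =
        Set.pi (s : Set ι) t ×ˢ Set.univ := by
      ext ⟨ω, x⟩
      simp only [Set.mem_preimage, Set.mem_pi, Set.mem_prod, Finset.mem_coe, Set.mem_univ,
        and_true]
      refine forall₂_congr fun i hi => ?_
      rw [Function.update_of_ne (ne_of_mem_of_not_mem hi hm)]
    rw [this, Measure.prod_prod, Measure.infinitePi_pi ν fun i _ => ht i, measure_univ, mul_one]

open MeasureTheory in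
/-- If, outside each finite set of coordinates, there is a coordinate that cannot by itself decide
a product event with conditional probability more than `c < 1`, then the event is null. -/
theorem MeasureTheory.Measure.infinitePi_eq_zero_of_forall_update_le {ι : Type*} [DecidableEq ι]
    {X : ι → Type*} [∀ i, MeasurableSpace (X i)] (ν : ∀ i, Measure (X i))
    [∀ i, IsProbabilityMeasure (ν i)] {A : Set (∀ i, X i)} (hA : MeasurableSet A) {c : NNReal}
    (hc : c < 1)
    (h : ∀ s : Finset ι, ∃ m ∉ s, ∀ ω, ν m {x | Function.update ω m x ∈ A} ≤ c) :
    Measure.infinitePi ν A = 0 := by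
  set P := Measure.infinitePi ν
  -- A cylinder `B` does not see the coordinate `m` outside its support, so resampling `m` bounds
  -- the probability of `A` given `B` by `c`. Approximating `A` itself by cylinders then gives `P A
  -- ≤ c * P A`.
  have hcyl : ∀ B ∈ measurableCylinders X, P (A ∩ B) ≤ c * P B := by
    intro B hB
    have hBm := MeasurableSet.of_mem_measurableCylinders hB
    obtain ⟨s, S, hS, rfl⟩ := (mem_measurableCylinders B).1 hB
    obtain ⟨m, hms, hm⟩ := h s
    set B := cylinder s S
    have hBu : ∀ ω x, Function.update ω m x ∈ B ↔ ω ∈ B := by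
      intro ω x
      have : s.restrict (Function.update ω m x) = s.restrict ω := by
        ext i
        exact Function.update_of_ne (ne_of_mem_of_not_mem i.2 hms) _ _
      simp only [B, mem_cylinder, this]
    calc P (A ∩ B) = ((P.prod (ν m)).map (fun p => Function.update p.1 m p.2)) (A ∩ B) := by
          rw [Measure.map_update_prod_infinitePi ν m]
      _ = ∫⁻ ω, ν m {x | Function.update ω m x ∈ A ∩ B} ∂P := by
          rw [Measure.map_apply measurable_update' (hA.inter hBm),
            Measure.prod_apply (measurable_update' (hA.inter hBm))]
          rfl
      _ ≤ ∫⁻ ω, B.indicator (fun _ => (c : ENNReal)) ω ∂P := by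
          refine lintegral_mono fun ω => ?_
          by_cases hω : ω ∈ B
          · rw [Set.indicator_of_mem hω]
            exact (measure_mono fun x hx => hx.1).trans (hm ω)
          · rw [Set.indicator_of_notMem hω]
            refine (measure_mono_null (t := ∅) (fun x hx => ?_) measure_empty).le
            exact hω ((hBu ω x).1 hx.2)
      _ = c * P B := lintegral_indicator_const hBm _
  have key : ∀ ε : ℝ, 0 < ε → P.real A ≤ c * (P.real A + ε) + ε := by
    intro ε hε
    obtain ⟨B, hB, hBA⟩ := exists_measure_symmDiff_lt_of_generateFrom_isSetRing (μ := P)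
      isSetRing_measurableCylinders
      ⟨{Set.univ}, Set.countable_singleton _, by
        simpa using univ_mem_measurableCylinders X, by simp⟩
      generateFrom_measurableCylinders.symm hA (ε := ε.toNNReal) (by simpa using hε)
    have hBε : P.real (symmDiff B A) ≤ ε := by
      have := ENNReal.toReal_mono ENNReal.coe_ne_top hBA.le
      simpa [Measure.real, hε.le] using this
    have h1 : P.real A ≤ P.real (A ∩ B) + ε := by
      refine (measureReal_mono (s₂ := (A ∩ B) ∪ symmDiff B A) fun x hx => ?_).trans
        ((measureReal_union_le _ _).trans (by gcongr))
      by_cases hxB : x ∈ B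
      · exact Or.inl ⟨hx, hxB⟩
      · exact Or.inr (Or.inr ⟨hx, hxB⟩)
    have h2 : P.real B ≤ P.real A + ε := by
      refine (measureReal_mono (s₂ := A ∪ symmDiff B A) fun x hx => ?_).trans
        ((measureReal_union_le _ _).trans (by gcongr))
      by_cases hxA : x ∈ A
      · exact Or.inl hxA
      · exact Or.inr (Or.inl ⟨hx, hxA⟩)
    have h3 : P.real (A ∩ B) ≤ c * P.real B := by
      have := ENNReal.toReal_mono (by finiteness) (hcyl B hB)
      simpa [Measure.real] using this
    have h4 : (c : ℝ) * P.real B ≤ c * (P.real A + ε) := by gcongr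
    linarith
  have hc' : (c : ℝ) < 1 := hc
  have h0 : P.real A ≤ 0 := by
    by_contra! hpos
    have := key ((1 - c) * P.real A / 4) (by
      have : 0 < 1 - (c : ℝ) := by linarith
      positivity)
    have h5 : 0 < (1 - (c : ℝ)) * P.real A := mul_pos (by linarith) hpos
    have h6 : (c : ℝ) * ((1 - c) * P.real A) ≤ (1 - c) * P.real A := by
      nlinarith
    nlinarith
  exact (measureReal_eq_zero_iff).1 (le_antisymm h0 measureReal_nonneg)

open MeasureTheory in
-- The witness is the law of a series of independent terms, the `n`-th in the ball of radius `2⁻ⁿ`.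
-- All sums have norm at most `2`, so for `m ≥ ‖w‖ + 2` the translation by `-w` and the other terms
-- together shift term `m` by at most `m`, and `ν m` gives the event conditional probability at most
-- `c`.
theorem isHaarNull_of_forall_exists_measure {X : Type*} [NormedAddCommGroup X] [NormedSpace ℝ X]
    [CompleteSpace X] [MeasurableSpace X] [BorelSpace X] [SecondCountableTopology X]
    {C : Set X} (hclosed : IsClosed C) {c : NNReal} (hc : c < 1)
    (h : ∀ r > 0, ∀ ρ : ℝ, ∃ ν : Measure X, IsProbabilityMeasure ν ∧
      ν (Metric.closedBall 0 r)ᶜ = 0 ∧ ∀ w, ‖w‖ ≤ ρ → ν {x | w + x ∈ C} ≤ c) :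
    IsHaarNull C := by
  refine ⟨hclosed.measurableSet, ?_⟩
  choose ν hν hνr hνC using fun n : ℕ => h ((1 / 2) ^ n) (by positivity) n
  -- Truncation changes nothing almost surely but makes the series converge everywhere.
  let g : ℕ → X → X := fun n => (Metric.closedBall 0 ((1 / 2) ^ n)).indicator id
  have hg : ∀ n, Measurable (g n) := fun n =>
    measurable_id.indicator Metric.isClosed_closedBall.measurableSet
  have hgn : ∀ n x, ‖g n x‖ ≤ (1 / 2) ^ n := by
    intro n x
    by_cases hx : x ∈ Metric.closedBall (0 : X) ((1 / 2) ^ n)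
    · exact (congrArg norm (Set.indicator_of_mem hx id)).trans_le (mem_closedBall_zero_iff.1 hx)
    · rw [show g n x = 0 from Set.indicator_of_notMem hx id, norm_zero]
      positivity
  have hsum : ∀ ω : ℕ → X, Summable fun n => g n (ω n) := fun ω =>
    Summable.of_norm_bounded summable_geometric_two fun n => hgn n (ω n)
  let S : (ℕ → X) → X := fun ω => ∑' n, g n (ω n)
  have hS : Measurable S := by
    refine measurable_of_tendsto_metrizable (f := fun N ω => ∑ n ∈ Finset.range N, g n (ω n))
      (fun N => ?_) ?_
    · exact Finset.measurable_fun_sum _ fun n _ => (hg n).comp (measurable_pi_apply n)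
    · exact tendsto_pi_nhds.2 fun ω => (hsum ω).hasSum.tendsto_sum_nat
  have hSn : ∀ ω, ‖S ω‖ ≤ 2 := fun ω =>
    tsum_of_norm_bounded hasSum_geometric_two fun n => hgn n (ω n)
  have hSu : ∀ ω m x, S (Function.update ω m x) = S (Function.update ω m 0) + g m x := by
    intro ω m x
    simp only [S]
    rw [(hsum _).tsum_eq_add_tsum_ite m, (hsum (Function.update ω m 0)).tsum_eq_add_tsum_ite m]
    have h0 : g m 0 = 0 := by
      rw [← norm_le_zero_iff]
      simp [g]
    have : ∀ y, (fun n => if n = m then 0 else g n (Function.update ω m y n)) =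
        fun n => if n = m then 0 else g n (ω n) := by
      intro y
      ext n
      split_ifs with hn
      · rfl
      · rw [Function.update_of_ne hn]
    rw [this, this, Function.update_self, Function.update_self, h0, zero_add, add_comm]
  refine ⟨(Measure.infinitePi ν).map S, Measure.isProbabilityMeasure_map hS.aemeasurable,
    fun w => ?_⟩
  have himage : (fun e => w + e) '' C = {x | -w + x ∈ C} := by
    rw [Set.image_add_left]
    rfl
  have hmeas : MeasurableSet {x | -w + x ∈ C} :=
    (hclosed.preimage (by fun_prop : Continuous fun x => -w + x)).measurableSet
  rw [himage, Measure.map_apply hS hmeas]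
  refine Measure.infinitePi_eq_zero_of_forall_update_le ν (hS hmeas) hc fun s => ?_
  obtain ⟨N, hN⟩ := exists_nat_ge (‖w‖ + 2)
  obtain ⟨m, hm⟩ := Infinite.exists_notMem_finset (s ∪ Finset.range N)
  rw [Finset.mem_union, not_or, Finset.mem_range, not_lt] at hm
  refine ⟨m, hm.1, fun ω => ?_⟩
  have hw : ‖-w + S (Function.update ω m 0)‖ ≤ m := by
    have := norm_add_le (-w) (S (Function.update ω m 0))
    rw [norm_neg] at this
    have hNm : (N : ℝ) ≤ m := by exact_mod_cast hm.2
    linarith [hSn (Function.update ω m 0)]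
  calc ν m {x | Function.update ω m x ∈ S ⁻¹' {x | -w + x ∈ C}}
      ≤ ν m ({x | -w + S (Function.update ω m 0) + x ∈ C} ∪
          (Metric.closedBall 0 ((1 / 2) ^ m))ᶜ) := by
        refine measure_mono fun x hx => ?_
        by_cases hxb : x ∈ Metric.closedBall (0 : X) ((1 / 2) ^ m)
        · left
          have hx' : -w + S (Function.update ω m x) ∈ C := hx
          rwa [hSu, ← add_assoc, show g m x = x from Set.indicator_of_mem hxb id] at hx'
        · exact Or.inr hxb
    _ ≤ _ := (measure_union_le _ _).trans_eq (by rw [hνr, add_zero])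
    _ ≤ c := hνC m _ hw

/-! ### From measures to looseness by minimax -/

open MeasureTheory in
/-- A symmetric measure giving mass more than `3 / 4` to a set meets it in antipodal pairs. -/
theorem half_lt_sum_of_measure_symm {X : Type*} [NormedAddCommGroup X] [MeasurableSpace X]
    {n : ℕ} {q : Fin n → ℝ} (hq : ∀ j, 0 ≤ q j) (hq1 : ∑ j, q j = 1) (x : Fin n → X) {D : Set X}
    (hD : MeasurableSet D) [DecidablePred fun j => x j ∈ D ∧ -x j ∈ D]
    (h : ENNReal.ofReal (3 / 4) < (∑ j, ENNReal.ofReal (q j / 2) •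
      (Measure.dirac (x j) + Measure.dirac (-x j))) D) :
    1 / 2 < ∑ j, q j * if x j ∈ D ∧ -x j ∈ D then 1 else 0 := by
  have h1 : (∑ j, ENNReal.ofReal (q j / 2) •
      (Measure.dirac (x j) + Measure.dirac (-x j))) D ≤
      ENNReal.ofReal (∑ j, q j / 2 * (1 + if x j ∈ D ∧ -x j ∈ D then 1 else 0)) := by
    rw [ENNReal.ofReal_sum_of_nonneg fun j _ => mul_nonneg (by linarith [hq j]) (by
      split_ifs <;> norm_num), Measure.finsetSum_apply]
    refine Finset.sum_le_sum fun j _ => ?_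
    rw [ENNReal.ofReal_mul (by linarith [hq j]), Measure.smul_apply, Measure.add_apply,
      smul_eq_mul, Measure.dirac_apply' _ hD, Measure.dirac_apply' _ hD]
    gcongr
    by_cases ha : x j ∈ D <;> by_cases hb : -x j ∈ D <;> norm_num [ha, hb]
  have h2 := (ENNReal.ofReal_lt_ofReal_iff_of_nonneg (by norm_num)).1 (h.trans_le h1)
  have h3 : ∑ j, q j / 2 * (1 + if x j ∈ D ∧ -x j ∈ D then (1 : ℝ) else 0) =
      1 / 2 * (∑ j, q j) + 1 / 2 * ∑ j, q j * if x j ∈ D ∧ -x j ∈ D then (1 : ℝ) else 0 := by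
    rw [Finset.mul_sum, Finset.mul_sum, ← Finset.sum_add_distrib]
    exact Finset.sum_congr rfl fun j _ => by ring
  rw [h3, hq1] at h2
  linarith

open MeasureTheory in
-- If no single `w` serves all points, separation in `ℝⁿ` gives weights `q` on the points, and the
-- symmetric measure with these weights contradicts the hypothesis. Symmetry puts `w` itself in `C`,
-- as a midpoint, so multiples of the points can be scaled down inside `C`.
theorem isLoose_of_forall_measure {X : Type*} [NormedAddCommGroup X] [NormedSpace ℝ X]
    [MeasurableSpace X] [BorelSpace X] {C : Set X} (hclosed : IsClosed C) (hconv : Convex ℝ C)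
    {ρ r : ℝ} (hr : 0 ≤ r)
    (h : ∀ ν : Measure X, IsProbabilityMeasure ν → ν (Metric.closedBall 0 r)ᶜ = 0 →
      ∃ w, ‖w‖ ≤ ρ ∧ ENNReal.ofReal (3 / 4) < ν {x | w + x ∈ C}) :
    IsLoose C ρ (r / 4) := by
  classical
  intro n x' hx' ε hε
  let x : Fin n → X := fun j => (4 : ℝ) • x' j
  have hx : ∀ j, ‖x j‖ ≤ r := by
    intro j
    simp only [x]
    rw [norm_smul, Real.norm_of_nonneg (by norm_num)]
    linarith [hx' j]
  let K : Set (Fin n → ℝ) := {a | ∃ w : X, ‖w‖ ≤ ρ ∧ ∃ b : Fin n → ℝ, (∀ j, a j ≤ b j) ∧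
    w ∈ C ∧ ∀ j, w + b j • x j ∈ C ∧ w - b j • x j ∈ C}
  have hK : Convex ℝ K := by
    rintro a ⟨w, hw, b, hab, hwC, hb⟩ a' ⟨w', hw', b', hab', hwC', hb'⟩ s t hs ht hst
    refine ⟨s • w + t • w', mem_closedBall_zero_iff.1 ((convex_closedBall (0 : X) ρ)
      (mem_closedBall_zero_iff.2 hw) (mem_closedBall_zero_iff.2 hw') hs ht hst),
      s • b + t • b', fun j => ?_, hconv hwC hwC' hs ht hst, fun j => ⟨?_, ?_⟩⟩
    · exact add_le_add (mul_le_mul_of_nonneg_left (hab j) hs)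
        (mul_le_mul_of_nonneg_left (hab' j) ht)
    · convert hconv (hb j).1 (hb' j).1 hs ht hst using 1
      simp only [Pi.add_apply, Pi.smul_apply, smul_eq_mul]
      module
    · convert hconv (hb j).2 (hb' j).2 hs ht hst using 1
      simp only [Pi.add_apply, Pi.smul_apply, smul_eq_mul]
      module
  -- A coordinate above `1 / 4` allows `x j = 4 x' j` to be scaled down to `x' j`. The constant
  -- vector `1 / 2` lies in this open set and is the one compared with the weight above `1 / 2`.
  let O : Set (Fin n → ℝ) := Set.pi Set.univ fun _ => Set.Ioi (1 / 4)
  suffices hOK : ¬ Disjoint O K by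
    obtain ⟨a, haO, w, hw, b, hab, hwC, hb⟩ := Set.not_disjoint_iff.1 hOK
    refine ⟨x', w, hw, fun j => by simpa using hε, fun j => ?_⟩
    have hbj : 1 / 4 < b j := lt_of_lt_of_le (haO j trivial) (hab j)
    have hbj0 : b j ≠ 0 := by linarith
    have := hconv hwC (hb j).1 (a := 1 - 1 / (4 * b j)) (b := 1 / (4 * b j))
      (by rw [sub_nonneg, div_le_one (by linarith)]; linarith)
      (by apply div_nonneg <;> linarith) (by ring)
    convert this using 1
    simp only [x]
    rw [smul_add, ← add_assoc, ← add_smul, sub_add_cancel, one_smul, smul_smul, smul_smul]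
    have : 1 / (4 * b j) * (b j * 4) = 1 := by field_simp
    rw [mul_assoc, this, one_smul]
  intro hdisj
  obtain ⟨f, u, hfO, hfK⟩ := geometric_hahn_banach_open
    (convex_pi fun _ _ => convex_Ioi _) (isOpen_set_pi Set.finite_univ fun _ _ => isOpen_Ioi)
    hK hdisj
  let p : Fin n → ℝ := fun j => -f (Pi.single j 1)
  have hfp : ∀ a, f a = -∑ j, p j * a j := by
    intro a
    conv_lhs => rw [pi_eq_sum_univ' a, map_sum]
    rw [← Finset.sum_neg_distrib]
    refine Finset.sum_congr rfl fun j _ => ?_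
    rw [map_smul, smul_eq_mul]
    ring
  -- The point mass at `0` gives a point of `C` in the `ρ`-ball; hence `K` contains the negative
  -- orthant, which forces `p ≥ 0`.
  obtain ⟨w₀, hw₀, hw₀C⟩ := h (Measure.dirac 0) inferInstance (by
    rw [Measure.dirac_apply' _ Metric.isClosed_closedBall.measurableSet.compl]
    simp [hr])
  have hw₀C : w₀ ∈ C := by
    have hm : MeasurableSet {x | w₀ + x ∈ C} :=
      (hclosed.preimage (by fun_prop : Continuous fun x => w₀ + x)).measurableSet
    rw [Measure.dirac_apply' _ hm] at hw₀C
    by_contra hcon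
    simp [Set.indicator, hcon] at hw₀C
  have hneg : ∀ a : Fin n → ℝ, (∀ j, a j ≤ 0) → a ∈ K := fun a ha =>
    ⟨w₀, hw₀, 0, ha, hw₀C, fun j => by simpa using hw₀C⟩
  have hu0 : u ≤ 0 := by simpa using hfK 0 (hneg 0 fun _ => le_rfl)
  have hp : ∀ j, 0 ≤ p j := by
    intro j
    by_contra! hj
    have h1 := hfK (Pi.single j ((u - 1) / (-p j))) (hneg _ fun i => by
      rcases eq_or_ne i j with rfl | hij
      · rw [Pi.single_eq_same]
        exact div_nonpos_of_nonpos_of_nonneg (by linarith) (by linarith)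
      · rw [Pi.single_eq_of_ne hij])
    rw [hfp, Finset.sum_eq_single j (fun i _ hij => by rw [Pi.single_eq_of_ne hij, mul_zero])
      (by simp), Pi.single_eq_same] at h1
    have : -(p j * ((u - 1) / -p j)) = u - 1 := by
      field_simp [hj.ne]
    linarith
  have hhalf : -u < (∑ j, p j) * (1 / 2) := by
    have h1 := hfO (fun _ => 1 / 2) fun j _ => by norm_num
    rw [hfp, ← Finset.sum_mul] at h1
    linarith
  set s := ∑ j, p j
  have hs : 0 < s := by linarith
  let q : Fin n → ℝ := fun j => p j / s
  have hq : ∀ j, 0 ≤ q j := fun j => div_nonneg (hp j) hs.le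
  have hq1 : ∑ j, q j = 1 := by
    simp only [q]
    rw [← Finset.sum_div]
    exact div_self hs.ne'
  let ν : Measure X := ∑ j, ENNReal.ofReal (q j / 2) •
      (Measure.dirac (x j) + Measure.dirac (-x j))
  obtain ⟨w, hw, hwν⟩ := h ν ⟨by
      simp only [ν, Measure.finsetSum_apply, Measure.smul_apply, Measure.add_apply, measure_univ,
        smul_eq_mul, one_add_one_eq_two]
      rw [← ENNReal.ofReal_ofNat 2]
      simp_rw [← ENNReal.ofReal_mul (div_nonneg (hq _) zero_le_two)]
      rw [← ENNReal.ofReal_sum_of_nonneg fun j _ => by linarith [hq j]]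
      simp [hq1]⟩ (by
      simp only [ν, Measure.finsetSum_apply, Measure.smul_apply, Measure.add_apply]
      refine Finset.sum_eq_zero fun j _ => ?_
      rw [Measure.dirac_apply' _ Metric.isClosed_closedBall.measurableSet.compl,
        Measure.dirac_apply' _ Metric.isClosed_closedBall.measurableSet.compl]
      simp [hx j])
  have hG := half_lt_sum_of_measure_symm hq hq1 x
    (hclosed.preimage (by fun_prop : Continuous fun x => w + x)).measurableSet hwν
  obtain ⟨j₀, hj₀⟩ : ∃ j, x j ∈ (fun x => w + x) ⁻¹' C ∧ -x j ∈ (fun x => w + x) ⁻¹' C := by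
    by_contra! hcon
    rw [Finset.sum_eq_zero fun j _ => by rw [if_neg fun h => hcon j h.1 h.2, mul_zero]] at hG
    norm_num at hG
  have hwC : w ∈ C := by
    convert hconv hj₀.1 hj₀.2 (a := 1 / 2) (b := 1 / 2) (by norm_num) (by norm_num)
      (by norm_num) using 1
    module
  -- The indicator of the antipodal pairs inside `C - w` belongs to `K`, but its `q`-weight exceeds
  -- `1 / 2`, against the separation.
  have h1 := hfK (fun j => if x j ∈ (fun x => w + x) ⁻¹' C ∧ -x j ∈ (fun x => w + x) ⁻¹' C
    then 1 else 0) ⟨w, hw, _, fun _ => le_rfl, hwC, fun j => by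
      split_ifs with hj
      · simpa [sub_eq_add_neg] using hj
      · simpa using hwC⟩
  have h2 : ∀ b : Fin n → ℝ, ∑ j, p j * b j = s * ∑ j, q j * b j := by
    intro b
    rw [Finset.mul_sum]
    refine Finset.sum_congr rfl fun j _ => ?_
    simp only [q]
    field_simp
  rw [hfp, h2] at h1
  nlinarith

/-! ### Haar positivity implies looseness, and the theorem -/

theorem IsHaarPositive.exists_isLoose {X : Type*} [NormedAddCommGroup X] [NormedSpace ℝ X]
    [CompleteSpace X] [MeasurableSpace X] [BorelSpace X] [TopologicalSpace.SeparableSpace X]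
    {C : Set X} (hclosed : IsClosed C) (hconv : Convex ℝ C) (h : IsHaarPositive C) :
    ∃ ρ > 0, ∃ r > 0, IsLoose C ρ r := by
  have : SecondCountableTopology X := UniformSpace.secondCountable_of_separable X
  by_contra! hcon
  refine h.2 (isHaarNull_of_forall_exists_measure hclosed (c := (3 / 4 : ℝ).toNNReal)
    (by rw [Real.toNNReal_lt_one]; norm_num) fun r hr ρ => ?_)
  by_contra! hν
  refine hcon (max ρ 1) (by positivity) (r / 4) (by positivity)
    (isLoose_of_forall_measure hclosed hconv hr.le fun ν hν1 hνr => ?_)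
  obtain ⟨w, hw, hwν⟩ := hν ν hν1 hνr
  exact ⟨w, hw.trans (le_max_left _ _), hwν⟩

theorem theorem3p1 {X : Type*} [NormedAddCommGroup X] [NormedSpace ℝ X] [CompleteSpace X]
    [MeasurableSpace X] [BorelSpace X]
    (C : Set X) (hne : C.Nonempty) (hclosed : IsClosed C) (hconv : Convex ℝ C) :
    (∀ ρ : ℝ, 0 < ρ →
      (∀ r : ℝ, 0 ≤ r → List.TFAE [
        (r : EReal) ≤ looseRadius C ρ,
        ∀ F : Set X, F.Finite → F ⊆ Metric.closedBall 0 r →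
          ∃ z : Bidual X, ‖z‖ ≤ ρ ∧
            ∀ x ∈ F, z + NormedSpace.inclusionInDoubleDual ℝ X x ∈ bidualClosure C,
        ∃ z₀ : Bidual X, ‖z₀‖ ≤ ρ ∧ Metric.closedBall z₀ r ⊆ bidualClosure C]) ∧
      looseRadius C ρ = innerRadius (bidualClosure C) ρ) ∧
    (TopologicalSpace.SeparableSpace X →
      (IsHaarPositive C ↔ (interior (bidualClosure C)).Nonempty)) := by
  refine ⟨fun ρ hρ => ⟨fun r hr => ?_, looseRadius_eq_innerRadius_bidualClosure hconv hρ.le⟩,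
    fun _ => ?_⟩
  · rw [le_looseRadius_iff hr]
    tfae_have 1 → 3 := exists_closedBall_subset_of_isLoose hconv hr
    tfae_have 3 → 2 := fun ⟨z, hz, hzC⟩ F _ hF =>
      ⟨z, hz, fun x hx => hzC (add_inclusionInDoubleDual_mem_closedBall z (hF hx))⟩
    tfae_have 2 → 1 := isLoose_of_forall_finite hconv hρ.le
    tfae_finish
  · rw [interior_bidualClosure_nonempty_iff hconv]
    exact ⟨fun h => h.exists_isLoose hclosed hconv,
      fun ⟨_, _, _, hr, h⟩ => h.isHaarPositive hclosed hconv hr⟩
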